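/- **Conventions.** Fix $\mathbb K\in\{\mathbb R,\mathbb C\}$, $k\in\mathbb N\cup\{\infty,\omega\}$, and one of two settings: *Banach* (ambient spaces are Banach spaces over $\mathbb K$, $C^k$ is meant in the sense of Fréchet derivatives) or *Fréchet* (ambient spaces are Fréchet spaces over $\mathbb K$, $C^k$ is meant in the sense of Michal–Bastiani–Hamilton; real analytic maps are those that extend locally to holomorphic maps of the complexifications). A *linear space* is a locally arcwise connected subspace with non-void interior of such an ambient space. A function from an open subset $U$ of a linear space to a linear space is $C^k$ if around every point of $U$ it is the restriction of a $C^k$ function defined on an open subset of the ambient space. *Model spaces.* A model space is a topological space $E$ with a category $\mathcal E$ whose objects (model neighborhoods) are open subsets of $E$ that cover $E$ and are closed under intersections of two, and whose morphisms are continuous functions between them, containing the identities and closed under composition, under restriction to smaller model neighborhoods in source and target, and under gluing: if morphisms $f_i\colon U_i\to V_i$ agree with a continuous $f\colon\bigcup U_i\to\bigcup V_i$ on the $U_i$, and both unions are objects, then $f$ is a morphism. It is $C^k$ linear if $E$ is a linear space and all morphisms are $C^k$. A model function is a continuous function for which preimages of model neighborhoods are model neighborhoods and the image of each model neighborhood lies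 in a model neighborhood. A subset of a model space carries all model neighborhoods contained in it and all morphisms among them; it is a model subspace if this is a model space (of a linear space: a linear model space). A model category is a category of model spaces and model functions that contains, with every object $S$, each of its model subspaces together with its inclusion into $S$, and each morphism $U\to V$ of $S$ for which $U$ and $V$ are model subspaces. A $C^k$ linear model category is a category of $C^k$ linear model spaces and $C^k$ model functions. $\operatorname{Triv}E$ is $E$ with all open sets and all continuous functions between them; $\operatorname{Triv}_{C^k}C$ is the linear space $C$ with all open sets and all $C^k$ functions between them. *Atlases.* A $C^k$ chart $(U,V,\varphi)$ of $E$ in $C$ is a homeomorphism $\varphi$ from an open $U\subseteq E$ onto an open $V\subseteq C$. Two charts are $C^k$ compatible if their domains are disjoint or the transition function is a $C^k$ diffeomorphism. A $C^k$-atlas is a set of pairwise compatible charts whose domains cover $E$, at least one of whose ranges contains a ball of the ambient space; it is maximal if it contains every chart that is compatible with all of its charts. M-charts, m-compatibility, m-atlases and maximal m-atlases of a model space $(E,\mathcal E)$ in a model space $(C,\mathcal C)$ are defined likewise, with model homeomorphisms between model neighborhoods as charts, isomorphisms of $\mathcal C$ as transition functions, and no condition on balls. A $C^k$-atlas morphism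 from $A^1$ (of $E^1$ in $C^1$) to $A^2$ (of $E^2$ in $C^2$) is a pair of a continuous $f_0\colon E^1\to E^2$ and a $C^k$ function $f_1\colon C^1\to C^2$ such that for all charts $(U^i,V^i,\varphi^i)\in A^i$ and all $x\in U^1\cap f_0^{-1}(U^2)$ there are open sets $U'\subseteq U^1\cap f_0^{-1}(U^2)$, $V'\subseteq V^1$, $U''\subseteq U^2$, $V''\subseteq V^2$, $\hat V\subseteq C^2$ and a $C^k$ diffeomorphism $\hat f\colon V''\to\hat V$ with $x\in U'$, $f_0(U')\subseteq U''$, $\varphi^1(U')\subseteq V'$, $\varphi^2(U'')\subseteq V''$, $f_1(V')\subseteq\hat V$, and $\hat f\circ\varphi^2\circ f_0=f_1\circ\varphi^1$ on $U'$. An m-atlas morphism is the same with model functions $f_0,f_1$, model neighborhoods in place of open sets, and isomorphisms of the coordinate model space in place of $C^k$ diffeomorphisms. *Manifolds and local coordinate spaces.* A $C^k$ manifold is a triple $(E,C,A)$ of a topological space $E$, a linear space $C$ and a maximal $C^k$-atlas $A$ of $E$ in $C$; its morphisms are the $C^k$-atlas morphisms. A local 2-$\emptyset$ coordinate space is $L=((\mathcal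 M_0,\mathcal M_1),(\mathbf E,\mathbf C),A,\emptyset,\emptyset)$ with model categories $\mathcal M_0$ (of topological model spaces) and $\mathcal M_1$ (of linear model spaces), objects $\mathbf E=(E,\mathcal E)$ of $\mathcal M_0$ and $\mathbf C=(C,\mathcal C)$ of $\mathcal M_1$, and a maximal m-atlas $A$ of $\mathbf E$ in $\mathbf C$. A strict morphism between two of them with the same pair of categories is an m-atlas morphism $(f_0,f_1)$ with $f_0$ in $\mathcal M_0$ and $f_1$ in $\mathcal M_1$. Put $F_{LCS,Man}(L):=(E,C,A)$, and let $F_{LCS,Man}$ be the identity on pairs of functions. Let $\mathsf E$ be a set of topological spaces, $\mathsf C$ a set of linear spaces, and $M=(\mathscr E,\mathscr C)$ a pair of a model category and a $C^k$ linear model category that contain, as full subcategories, the spaces $\operatorname{Triv}E$ ($E\in\mathsf E$) with all continuous functions and the spaces $\operatorname{Triv}_{C^k}C$ ($C\in\mathsf C$) with all $C^k$ functions, respectively. Let $Man^{C^k}(\mathsf E,\mathsf C)$ consist of the $C^k$ manifolds $(E,C,A)$ with $E\in\mathsf E$, $C\in\mathsf C$ and their morphisms. Put $F^{C^k,M}_{Man,LCS}(E,C,A):=(M,(\operatorname{Triv}E,\operatorname{Triv}_{C^k}C),A,\emptyset,\emptyset)$,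 the identity on pairs of functions, and let $LCS^{C^k,M}(\mathsf E,\mathsf C)$ consist of the images of the objects and morphisms of $Man^{C^k}(\mathsf E,\mathsf C)$ under $F^{C^k,M}_{Man,LCS}$. **Theorem.** 1. Let $L=((\mathcal M_0,\mathcal M_1),((E,\mathcal E),(C,\mathcal C)),A,\emptyset,\emptyset)$ be a local 2-$\emptyset$ coordinate space such that $\mathcal M_1$ is a $C^k$ linear model category and $A$ is a maximal $C^k$-atlas of $E$ in $C$. Then $F_{LCS,Man}(L)=(E,C,A)$ is a $C^k$ manifold. If $(E,\mathcal E)=\operatorname{Triv}E$ and $(C,\mathcal C)=\operatorname{Triv}_{C^k}C$, then it suffices to assume, instead of $A$ being a maximal $C^k$-atlas, that the range of some chart of $A$ contains a ball. 2. If $\mathscr C$ is also a model category, then the objects of $LCS^{C^k,M}(\mathsf E,\mathsf C)$ are local 2-$\emptyset$ coordinate spaces and its arrows are strict morphisms of them. 3. $Man^{C^k}(\mathsf E,\mathsf C)$ and $LCS^{C^k,M}(\mathsf E,\mathsf C)$ are categories (under composition of pairs of functions), $F_{LCS,Man}$ is a functor from $LCS^{C^k,M}(\mathsf E,\mathsf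 C)$ to $Man^{C^k}(\mathsf E,\mathsf C)$, $F^{C^k,M}_{Man,LCS}$ is a functor from $Man^{C^k}(\mathsf E,\mathsf C)$ to $LCS^{C^k,M}(\mathsf E,\mathsf C)$, and the two are mutually inverse: $$F_{LCS,Man}\circ F^{C^k,M}_{Man,LCS}=\mathrm{Id},\qquad F^{C^k,M}_{Man,LCS}\circ F_{LCS,Man}=\mathrm{Id}.$$ -/

import Mathlib

open CategoryTheory Set Topology

universe t u v w

namespace LocalCoord

/-! ### Differential calculus -/

section Calculus

/-- `f` is of class `C^n` on the open set `O` in the sense of Michal, Bastiani and Hamilton: `f` is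
continuous, all directional derivatives `df (x, v)` exist for `x ∈ O`, and `df` is of class
`C^(n-1)` on `O × V`. -/
def BastianiOn (𝕜 : Type w) [NontriviallyNormedField 𝕜] {W : Type v} [AddCommGroup W] [Module 𝕜 W]
    [TopologicalSpace W] :
    ℕ → ∀ {V : Type u} [AddCommGroup V] [Module 𝕜 V] [TopologicalSpace V], (V → W) → Set V → Prop
  | 0, _, _, _, _, f, O => ContinuousOn f O
  | n + 1, V, _, _, _, f, O => ContinuousOn f O ∧ ∃ df : V × V → W,
      (∀ x ∈ O, ∀ h : V, Filter.Tendsto (fun r : 𝕜 => r⁻¹ • (f (x + r • h) - f x))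
        (𝓝[≠] (0 : 𝕜)) (𝓝 (df (x, h)))) ∧
      BastianiOn 𝕜 n df (O ×ˢ univ)

/-- The complexification `V ⊕ iV` of a real topological vector space; `(x, y)` stands for
`x + iy`. -/
def Complexified (V : Type u) : Type u := V × V

namespace Complexified

variable (V : Type u)

instance [AddCommGroup V] : AddCommGroup (Complexified V) :=
  inferInstanceAs (AddCommGroup (V × V))

instance [TopologicalSpace V] : TopologicalSpace (Complexified V) :=
  inferInstanceAs (TopologicalSpace (V × V))

instance [AddCommGroup V] [Module ℝ V] : Module ℂ (Complexified V) where
  smul z p := (z.re • p.1 - z.im • p.2, z.re • p.2 + z.im • p.1)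
  one_smul p := Prod.ext
    (show (1 : ℂ).re • p.1 - (1 : ℂ).im • p.2 = p.1 by simp)
    (show (1 : ℂ).re • p.2 + (1 : ℂ).im • p.1 = p.2 by simp)
  mul_smul a b p := Prod.ext
    (show (a * b).re • p.1 - (a * b).im • p.2
        = a.re • (b.re • p.1 - b.im • p.2) - a.im • (b.re • p.2 + b.im • p.1) by
      simp only [Complex.mul_re, Complex.mul_im]; module)
    (show (a * b).re • p.2 + (a * b).im • p.1
        = a.re • (b.re • p.2 + b.im • p.1) + a.im • (b.re • p.1 - b.im • p.2) by
      simp only [Complex.mul_re, Complex.mul_im]; module)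
  smul_zero a := Prod.ext
    (show a.re • (0 : V) - a.im • (0 : V) = 0 by simp)
    (show a.re • (0 : V) + a.im • (0 : V) = 0 by simp)
  smul_add a p q := Prod.ext
    (show a.re • (p.1 + q.1) - a.im • (p.2 + q.2)
        = (a.re • p.1 - a.im • p.2) + (a.re • q.1 - a.im • q.2) by module)
    (show a.re • (p.2 + q.2) + a.im • (p.1 + q.1)
        = (a.re • p.2 + a.im • p.1) + (a.re • q.2 + a.im • q.1) by module)
  add_smul a b p := Prod.ext
    (show (a + b).re • p.1 - (a + b).im • p.2
        = (a.re • p.1 - a.im • p.2) + (b.re • p.1 - b.im • p.2) by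
      simp only [Complex.add_re, Complex.add_im]; module)
    (show (a + b).re • p.2 + (a + b).im • p.1
        = (a.re • p.2 + a.im • p.1) + (b.re • p.2 + b.im • p.1) by
      simp only [Complex.add_re, Complex.add_im]; module)
  zero_smul p := Prod.ext
    (show (0 : ℂ).re • p.1 - (0 : ℂ).im • p.2 = 0 by simp)
    (show (0 : ℂ).re • p.2 + (0 : ℂ).im • p.1 = 0 by simp)

end Complexified

/-- `f` is real analytic on the open set `O`: around every point of `O` it extends to a complex
`C^∞` (that is, holomorphic) map between the complexifications. -/
def RealAnalyticOn {V : Type u} {W : Type v} [AddCommGroup V] [Module ℝ V] [TopologicalSpace V]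
    [AddCommGroup W] [Module ℝ W] [TopologicalSpace W] (f : V → W) (O : Set V) : Prop :=
  ∀ x ∈ O, ∃ (D : Set (Complexified V)) (F : Complexified V → Complexified W),
    IsOpen D ∧ ((x, 0) : V × V) ∈ D ∧ (∀ m : ℕ, BastianiOn ℂ m F D) ∧
      ∀ y ∈ O, ((y, 0) : V × V) ∈ D → F ((y, 0) : V × V) = ((f y, 0) : W × W)

/-- `f` is of class `C^k` on the open set `O`, for locally convex spaces over `𝕜` (`ℝ` or `ℂ`). For
`𝕜 = ℂ` the last condition is automatic, since complex `C^∞` maps are analytic; for `𝕜 = ℝ` it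
implies the first one for `k = ω`. -/
def LocallyConvexCkOn (𝕜 : Type w) [RCLike 𝕜] {V : Type u} {W : Type v} [AddCommGroup V]
    [Module ℝ V] [Module 𝕜 V] [TopologicalSpace V] [AddCommGroup W] [Module ℝ W] [Module 𝕜 W]
    [TopologicalSpace W] (k : WithTop ℕ∞) (f : V → W) (O : Set V) : Prop :=
  (∀ m : ℕ, (m : WithTop ℕ∞) ≤ k → BastianiOn 𝕜 m f O) ∧ (k = ⊤ → RealAnalyticOn f O)

end Calculus

/-! ### Linear spaces -/

/-- The two settings of calculus: Banach spaces with Fréchet derivatives, and Fréchet spaces with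
the Michal–Bastiani–Hamilton notion of `C^k`. (For finite `k` and infinite-dimensional Banach spaces
these are different notions of `C^k`.) -/
inductive Setting
  | banach
  | frechet

/-- Banach spaces, respectively Fréchet spaces (Hausdorff, complete, metrizable, locally convex),
over `𝕜`. -/
inductive Ambient (𝕜 : Type w) [RCLike 𝕜] : Setting → Type (max w (v + 1))
  | banach (V : Type v) [NormedAddCommGroup V] [NormedSpace 𝕜 V] [CompleteSpace V] :
      Ambient 𝕜 Setting.banach
  | frechet (V : Type v) [AddCommGroup V] [Module ℝ V] [Module 𝕜 V] [IsScalarTower ℝ 𝕜 V]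
      [UniformSpace V] [IsUniformAddGroup V] [ContinuousSMul 𝕜 V] [LocallyConvexSpace ℝ V]
      [T2Space V] [(uniformity V).IsCountablyGenerated] [CompleteSpace V] :
      Ambient 𝕜 Setting.frechet

variable {s : Setting} {𝕜 : Type w} [RCLike 𝕜]

/-- The underlying set of vectors. -/
def Ambient.Vec : ∀ {s : Setting}, Ambient.{v} 𝕜 s → Type v
  | _, @Ambient.banach _ _ V _ _ _ => V
  | _, @Ambient.frechet _ _ V _ _ _ _ _ _ _ _ _ _ _ => V

instance Ambient.topology : ∀ {s : Setting} (A : Ambient.{v} 𝕜 s), TopologicalSpace A.Vec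
  | _, @Ambient.banach _ _ V _ _ _ => inferInstanceAs (TopologicalSpace V)
  | _, @Ambient.frechet _ _ V _ _ _ _ _ _ _ _ _ _ _ => inferInstanceAs (TopologicalSpace V)

/-- `g` is of class `C^k` on the open subset `O` of a Banach or Fréchet space; here
`k ∈ ℕ ∪ {∞, ω}`. -/
def Ambient.CkOn (k : WithTop ℕ∞) :
    ∀ {s : Setting} {A B : Ambient.{v} 𝕜 s}, (A.Vec → B.Vec) → Set A.Vec → Prop
  | _, @Ambient.banach _ _ V _ _ _, @Ambient.banach _ _ W _ _ _, g, O =>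
      ContDiffOn 𝕜 k (E := V) (F := W) g O
  | _, @Ambient.frechet _ _ V _ _ _ _ _ _ _ _ _ _ _, @Ambient.frechet _ _ W _ _ _ _ _ _ _ _ _ _ _,
      g, O => LocallyConvexCkOn 𝕜 (V := V) (W := W) k g O

/-- A subset of a Banach or Fréchet space, with the relative topology. -/
structure LinSpace (s : Setting) (𝕜 : Type w) [RCLike 𝕜] : Type (max w (v + 1)) where
  amb : Ambient.{v} 𝕜 s
  carrier : Set amb.Vec

/-- The points of a subset of a Banach or Fréchet space. -/
abbrev LinSpace.Pt (C : LinSpace.{v} s 𝕜) : Type v := C.carrier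

/-- A linear space: a locally arcwise connected subspace with non-void interior of a Banach or
Fréchet space. -/
def LinSpace.IsLinear (C : LinSpace.{v} s 𝕜) : Prop :=
  LocallyPathConnectedSpace C.Pt ∧ (interior C.carrier).Nonempty

/-- `f` is of class `C^k` on `U ⊆ C` as a function to `D`: around every point of `U` it is the
restriction of a `C^k` function on an open set of the ambient space. Only the values of `f` on `U`
matter. -/
def CkOn (k : WithTop ℕ∞) {C D : LinSpace.{v} s 𝕜} (f : C.Pt → D.Pt) (U : Set C.Pt) : Prop :=
  ∀ x ∈ U, ∃ (O : Set C.amb.Vec) (g : C.amb.Vec → D.amb.Vec), IsOpen O ∧ (x : C.amb.Vec) ∈ O ∧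
    Ambient.CkOn k g O ∧ ∀ y ∈ U, (y : C.amb.Vec) ∈ O → g y = f y

/-- A homeomorphism between open subsets that is of class `C^k` together with its inverse. -/
def IsCkDiffeo (k : WithTop ℕ∞) {C D : LinSpace.{v} s 𝕜} (h : OpenPartialHomeomorph C.Pt D.Pt) :
    Prop :=
  CkOn k h h.source ∧ CkOn k h.symm h.target

/-! ### Model spaces -/

/-- The kinds of spaces (topological spaces, linear spaces) that can carry a model structure:
`ok` singles out the admissible ones, and `sub S X` is the subset `X` of `S` regarded as a
space. -/
class SpaceKind (T : Type t) where
  Pt : T → Type v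
  top : ∀ S : T, TopologicalSpace (Pt S)
  ok : T → Prop
  sub : ∀ S : T, Set (Pt S) → T
  incl : ∀ (S : T) (X : Set (Pt S)), Pt (sub S X) → Pt S

attribute [reducible, instance] SpaceKind.top

instance : SpaceKind.{u + 1, u} TopCat.{u} where
  Pt S := S
  top _ := inferInstance
  ok _ := True
  sub _ X := TopCat.of X
  incl _ _ x := x.1

instance : SpaceKind.{max w (v + 1), v} (LinSpace.{v} s 𝕜) where
  Pt C := C.Pt
  top _ := inferInstance
  ok C := C.IsLinear
  sub C X := ⟨C.amb, Subtype.val '' X⟩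
  incl C X x := ⟨x.1, Subtype.coe_image_subset C.carrier X x.2⟩

/-- A family of subsets of `X` (the objects, called model neighborhoods) and of functions between
them: `mor U V f` says that `f` restricted to `U` is a morphism from `U` to `V`. -/
structure PreModel (X : Type v) where
  nbhd : Set (Set X)
  mor : Set X → Set X → (X → X) → Prop

/-- The axioms of a model space. -/
structure PreModel.IsModel {X : Type v} [TopologicalSpace X] (P : PreModel X) : Prop where
  nbhd_open : ∀ U ∈ P.nbhd, IsOpen U
  cover : ⋃₀ P.nbhd = univ
  inter : ∀ U ∈ P.nbhd, ∀ V ∈ P.nbhd, U ∩ V ∈ P.nbhd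
  mor_obj : ∀ U V f, P.mor U V f → U ∈ P.nbhd ∧ V ∈ P.nbhd
  mor_cont : ∀ U V f, P.mor U V f → MapsTo f U V ∧ ContinuousOn f U
  mor_congr : ∀ U V f g, EqOn f g U → P.mor U V f → P.mor U V g
  mor_id : ∀ U ∈ P.nbhd, P.mor U U id
  mor_comp : ∀ U V W f g, P.mor U V f → P.mor V W g → P.mor U W (g ∘ f)
  mor_restrict : ∀ U V U' V' f, P.mor U V f → U' ∈ P.nbhd → U' ⊆ U → V' ∈ P.nbhd → V' ⊆ V →
    MapsTo f U' V' → P.mor U' V' f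
  sheaf : ∀ (ι : Type v) (U V : ι → Set X) (f : ι → X → X) (g : X → X),
    (∀ i, P.mor (U i) (V i) (f i)) → (⋃ i, U i) ∈ P.nbhd → (⋃ i, V i) ∈ P.nbhd →
    MapsTo g (⋃ i, U i) (⋃ i, V i) → ContinuousOn g (⋃ i, U i) → (∀ i, EqOn g (f i) (U i)) →
    P.mor (⋃ i, U i) (⋃ i, V i) g

/-- An isomorphism of the category of a model space. -/
def PreModel.IsIso {X : Type v} [TopologicalSpace X] (P : PreModel X)
    (h : OpenPartialHomeomorph X X) : Prop :=
  P.mor h.source h.target h ∧ P.mor h.target h.source h.symm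

/-- The objects contained in a subset (the range of the inclusion `i`), with all the morphisms
among them. -/
def PreModel.pull {X Y : Type v} (i : Y → X) (P : PreModel X) : PreModel Y where
  nbhd := {U | i '' U ∈ P.nbhd}
  mor U V f := ∃ g, P.mor (i '' U) (i '' V) g ∧ ∀ y ∈ U, g (i y) = i (f y)

/-- The trivial model structure: open sets and continuous functions. -/
def trivModel (X : Type v) [TopologicalSpace X] : PreModel X where
  nbhd := {U | IsOpen U}
  mor U V f := IsOpen U ∧ IsOpen V ∧ MapsTo f U V ∧ ContinuousOn f U

/-- The trivial `C^k` linear model structure: open sets and `C^k` functions. -/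
def trivCkModel (k : WithTop ℕ∞) (C : LinSpace.{v} s 𝕜) : PreModel C.Pt where
  nbhd := {U | IsOpen U}
  mor U V f := IsOpen U ∧ IsOpen V ∧ MapsTo f U V ∧ CkOn k f U

/-- A space together with the data of a model space. -/
structure ModelSpace (T : Type t) [SpaceKind.{t, v} T] where
  space : T
  model : PreModel (SpaceKind.Pt space)

namespace ModelSpace

variable {T : Type t} [SpaceKind.{t, v} T]

/-- The points of a model space. -/
abbrev Pt (S : ModelSpace.{t, v} T) : Type v := SpaceKind.Pt S.space

/-- `S` is a model space (a linear model space, if `T` is the type of linear spaces). -/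
def IsModelSpace (S : ModelSpace.{t, v} T) : Prop := SpaceKind.ok S.space ∧ S.model.IsModel

/-- The subset `X` with all the objects contained in it; a model subspace if it is a model space. -/
def sub (S : ModelSpace.{t, v} T) (X : Set S.Pt) : ModelSpace.{t, v} T :=
  ⟨SpaceKind.sub S.space X, S.model.pull (SpaceKind.incl S.space X)⟩

/-- Model functions. -/
def IsModelFunction {T' : Type u} [SpaceKind.{u, w} T'] (S : ModelSpace.{t, v} T)
    (R : ModelSpace.{u, w} T') (f : S.Pt → R.Pt) : Prop :=
  Continuous f ∧ (∀ V ∈ R.model.nbhd, f ⁻¹' V ∈ S.model.nbhd) ∧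
    ∀ U ∈ S.model.nbhd, ∃ V ∈ R.model.nbhd, f '' U ⊆ V

end ModelSpace

/-- The trivial model space of a topological space. -/
def triv (E : TopCat.{u}) : ModelSpace.{u + 1, u} TopCat.{u} := ⟨E, trivModel E⟩

/-- The trivial `C^k` linear model space of a linear space. -/
def trivCk (k : WithTop ℕ∞) (C : LinSpace.{v} s 𝕜) : ModelSpace (LinSpace.{v} s 𝕜) :=
  ⟨C, trivCkModel k C⟩

/-- A `C^k` linear model space: a linear model space all of whose morphisms are `C^k`. -/
def IsCkLinearModelSpace (k : WithTop ℕ∞) (S : ModelSpace (LinSpace.{v} s 𝕜)) : Prop :=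
  S.IsModelSpace ∧ ∀ U V f, S.model.mor U V f → CkOn (C := S.space) (D := S.space) k f U

/-! ### Categories of model spaces -/

/-- A collection of spaces (with the data of a model space) and functions between them. -/
structure SpaceCat (T : Type t) [SpaceKind.{t, v} T] where
  obj : Set (ModelSpace.{t, v} T)
  mor : ∀ S R : ModelSpace.{t, v} T, (S.Pt → R.Pt) → Prop

namespace SpaceCat

variable {T : Type t} [SpaceKind.{t, v} T]

/-- The collection is a category under functional composition. -/
structure IsCat (M : SpaceCat.{t, v} T) : Prop where
  mor_obj : ∀ S R f, M.mor S R f → S ∈ M.obj ∧ R ∈ M.obj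
  mor_id : ∀ S ∈ M.obj, M.mor S S id
  mor_comp : ∀ S R Q f g, M.mor S R f → M.mor R Q g → M.mor S Q (g ∘ f)

/-- Model categories. -/
structure IsModelCategory (M : SpaceCat.{t, v} T) : Prop extends M.IsCat where
  obj_model : ∀ S ∈ M.obj, S.IsModelSpace
  mor_model : ∀ S R f, M.mor S R f → S.IsModelFunction R f
  sub_obj : ∀ S ∈ M.obj, ∀ X : Set S.Pt, (S.sub X).IsModelSpace →
    S.sub X ∈ M.obj ∧ M.mor (S.sub X) S (SpaceKind.incl S.space X)
  sub_mor : ∀ S ∈ M.obj, ∀ (U V : Set S.Pt) (f : S.Pt → S.Pt), S.model.mor U V f →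
    (S.sub U).IsModelSpace → (S.sub V).IsModelSpace → ∀ g : (S.sub U).Pt → (S.sub V).Pt,
    (∀ x, SpaceKind.incl S.space V (g x) = f (SpaceKind.incl S.space U x)) →
    M.mor (S.sub U) (S.sub V) g

end SpaceCat

/-- `C^k` linear model categories: the objects are `C^k` linear model spaces and the morphisms are
`C^k` model functions. -/
structure IsCkLinearModelCategory (k : WithTop ℕ∞) (M : SpaceCat (LinSpace.{v} s 𝕜)) : Prop
    extends M.IsCat where
  obj_linear : ∀ S ∈ M.obj, IsCkLinearModelSpace k S
  mor_Ck : ∀ S R f, M.mor S R f →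
    S.IsModelFunction R f ∧ CkOn (C := S.space) (D := R.space) k f univ

/-- The category of all continuous functions between the trivial model spaces of the spaces in `Es`
is a full subcategory of `M`. -/
def ContainsTriv (Es : Set TopCat.{u}) (M : SpaceCat TopCat.{u}) : Prop :=
  (∀ E ∈ Es, triv E ∈ M.obj) ∧
    ∀ E ∈ Es, ∀ E' ∈ Es, ∀ f : E → E', M.mor (triv E) (triv E') f ↔ Continuous f

/-- The category of all `C^k` functions between the trivial `C^k` linear model spaces of the spaces
in `Cs` is a full subcategory of `M`. -/
def ContainsTrivCk (k : WithTop ℕ∞) (Cs : Set (LinSpace.{v} s 𝕜))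
    (M : SpaceCat (LinSpace.{v} s 𝕜)) : Prop :=
  (∀ C ∈ Cs, trivCk k C ∈ M.obj) ∧
    ∀ C ∈ Cs, ∀ C' ∈ Cs, ∀ f : C.Pt → C'.Pt, M.mor (trivCk k C) (trivCk k C') f ↔ CkOn k f univ

/-! ### Atlases -/

section CkAtlas

variable {E : Type u} [TopologicalSpace E] {C : LinSpace.{v} s 𝕜}

/-- `C^k` compatibility of the `C^k` charts `φ`, `ψ` of `E` in `C`. A chart `(U, V, φ)` is a
homeomorphism from the open set `U = φ.source` of `E` to the open set `V = φ.target` of `C`. -/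
def CkCompatible (k : WithTop ℕ∞) (φ ψ : OpenPartialHomeomorph E C.Pt) : Prop :=
  Disjoint φ.source ψ.source ∨ IsCkDiffeo k (φ.symm.trans ψ)

/-- `C^k`-atlases. A subset of a Banach or Fréchet space contains a ball iff it has an interior
point. -/
structure IsCkAtlas (k : WithTop ℕ∞) (A : Set (OpenPartialHomeomorph E C.Pt)) : Prop where
  compatible : ∀ φ ∈ A, ∀ ψ ∈ A, CkCompatible k φ ψ
  cover : ∀ x : E, ∃ φ ∈ A, x ∈ φ.source
  ball : ∃ φ ∈ A, (interior ((fun p : C.Pt => (p : C.amb.Vec)) '' φ.target)).Nonempty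

/-- Maximal `C^k`-atlases. -/
structure IsMaximalCkAtlas (k : WithTop ℕ∞) (A : Set (OpenPartialHomeomorph E C.Pt)) : Prop
    extends IsCkAtlas k A where
  maximal : ∀ φ : OpenPartialHomeomorph E C.Pt, (∀ ψ ∈ A, CkCompatible k φ ψ) → φ ∈ A

/-- `C^k`-atlas morphisms. -/
structure IsCkAtlasMorphism (k : WithTop ℕ∞) {E' : Type u} [TopologicalSpace E']
    {C' : LinSpace.{v} s 𝕜} (A : Set (OpenPartialHomeomorph E C.Pt))
    (A' : Set (OpenPartialHomeomorph E' C'.Pt)) (f₀ : E → E') (f₁ : C.Pt → C'.Pt) : Prop where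
  cont : Continuous f₀
  Ck : CkOn k f₁ univ
  nearly_commutes : ∀ φ ∈ A, ∀ φ' ∈ A', ∀ x ∈ φ.source ∩ f₀ ⁻¹' φ'.source,
    ∃ (U : Set E) (V : Set C.Pt) (U' : Set E') (h : OpenPartialHomeomorph C'.Pt C'.Pt),
      IsOpen U ∧ U ⊆ φ.source ∩ f₀ ⁻¹' φ'.source ∧ IsOpen V ∧ V ⊆ φ.target ∧
      IsOpen U' ∧ U' ⊆ φ'.source ∧ h.source ⊆ φ'.target ∧ IsCkDiffeo k h ∧
      x ∈ U ∧ f₁ (φ x) ∈ h.target ∧ MapsTo f₀ U U' ∧ MapsTo φ U V ∧ MapsTo f₁ V h.target ∧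
      MapsTo φ' U' h.source ∧ ∀ y ∈ U, h (φ' (f₀ y)) = f₁ (φ y)

end CkAtlas

section MAtlas

variable {T : Type t} [SpaceKind.{t, u} T] {T' : Type w} [SpaceKind.{w, v} T']
  {E : ModelSpace.{t, u} T} {C : ModelSpace.{w, v} T'}

/-- M-charts: model homeomorphisms from a model neighborhood of `E` to a model neighborhood
of `C`. -/
structure IsMChart (φ : OpenPartialHomeomorph E.Pt C.Pt) : Prop where
  source : φ.source ∈ E.model.nbhd
  target : φ.target ∈ C.model.nbhd
  preimage : ∀ V ∈ C.model.nbhd, V ⊆ φ.target → φ.source ∩ φ ⁻¹' V ∈ E.model.nbhd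
  image : ∀ U ∈ E.model.nbhd, U ⊆ φ.source → φ '' U ∈ C.model.nbhd

/-- M-compatibility of m-charts. -/
def MCompatible (φ ψ : OpenPartialHomeomorph E.Pt C.Pt) : Prop :=
  Disjoint φ.source ψ.source ∨ C.model.IsIso (φ.symm.trans ψ)

/-- M-atlases. -/
structure IsMAtlas (A : Set (OpenPartialHomeomorph E.Pt C.Pt)) : Prop where
  chart : ∀ φ ∈ A, IsMChart φ
  compatible : ∀ φ ∈ A, ∀ ψ ∈ A, MCompatible φ ψ
  cover : ∀ x : E.Pt, ∃ φ ∈ A, x ∈ φ.source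

/-- Maximal m-atlases. -/
structure IsMaximalMAtlas (A : Set (OpenPartialHomeomorph E.Pt C.Pt)) : Prop
    extends IsMAtlas A where
  maximal : ∀ φ : OpenPartialHomeomorph E.Pt C.Pt, IsMChart φ → (∀ ψ ∈ A, MCompatible φ ψ) → φ ∈ A

/-- M-atlas morphisms. -/
structure IsMAtlasMorphism {E' : ModelSpace.{t, u} T} {C' : ModelSpace.{w, v} T'}
    (A : Set (OpenPartialHomeomorph E.Pt C.Pt)) (A' : Set (OpenPartialHomeomorph E'.Pt C'.Pt))
    (f₀ : E.Pt → E'.Pt) (f₁ : C.Pt → C'.Pt) : Prop where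
  model₀ : E.IsModelFunction E' f₀
  model₁ : C.IsModelFunction C' f₁
  nearly_commutes : ∀ φ ∈ A, ∀ φ' ∈ A', ∀ x ∈ φ.source ∩ f₀ ⁻¹' φ'.source,
    ∃ U ∈ E.model.nbhd, ∃ V ∈ C.model.nbhd, ∃ U' ∈ E'.model.nbhd,
    ∃ h : OpenPartialHomeomorph C'.Pt C'.Pt,
      U ⊆ φ.source ∩ f₀ ⁻¹' φ'.source ∧ V ⊆ φ.target ∧ U' ⊆ φ'.source ∧ h.source ⊆ φ'.target ∧
      C'.model.IsIso h ∧
      x ∈ U ∧ f₁ (φ x) ∈ h.target ∧ MapsTo f₀ U U' ∧ MapsTo φ U V ∧ MapsTo f₁ V h.target ∧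
      MapsTo φ' U' h.source ∧ ∀ y ∈ U, h (φ' (f₀ y)) = f₁ (φ y)

end MAtlas

/-! ### Manifolds and local coordinate spaces -/

/-- Triples `(E, C, A)` of a topological space, a subset of a Banach or Fréchet space and a set of
charts. -/
structure ManData (s : Setting) (𝕜 : Type w) [RCLike 𝕜] where
  space : TopCat.{u}
  coord : LinSpace.{v} s 𝕜
  atlas : Set (OpenPartialHomeomorph space coord.Pt)

/-- `(E, C, A)` is a `C^k` manifold. -/
def IsCkManifold (k : WithTop ℕ∞) (S : ManData.{u, v} s 𝕜) : Prop :=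
  S.coord.IsLinear ∧ IsMaximalCkAtlas k S.atlas

/-- The arrows are all pairs of functions `f₀ : E¹ → E²`, `f₁ : C¹ → C²`. -/
instance : Category (ManData.{u, v} s 𝕜) where
  Hom S S' := (S.space → S'.space) × (S.coord.Pt → S'.coord.Pt)
  id _ := (id, id)
  comp f g := (g.1 ∘ f.1, g.2 ∘ f.2)

/-- The data `((𝓜₀, 𝓜₁), (E, C), A, ∅, ∅)` of a local 2-∅ coordinate space: the empty sequences of
adjunct functions and of signatures carry no information and are omitted. -/
structure LCSData (s : Setting) (𝕜 : Type w) [RCLike 𝕜] where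
  totalCat : SpaceCat TopCat.{u}
  coordCat : SpaceCat (LinSpace.{v} s 𝕜)
  total : ModelSpace TopCat.{u}
  coord : ModelSpace (LinSpace.{v} s 𝕜)
  atlas : Set (OpenPartialHomeomorph total.Pt coord.Pt)

/-- `L` is a local 2-∅ coordinate space. -/
structure IsLCS (L : LCSData.{u, v} s 𝕜) : Prop where
  total_cat : L.totalCat.IsModelCategory
  coord_cat : L.coordCat.IsModelCategory
  total_mem : L.total ∈ L.totalCat.obj
  coord_mem : L.coord ∈ L.coordCat.obj
  atlas : IsMaximalMAtlas L.atlas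

/-- The arrows are all pairs of functions `f₀ : E¹ → E²`, `f₁ : C¹ → C²`. -/
instance : Category (LCSData.{u, v} s 𝕜) where
  Hom L L' := (L.total.Pt → L'.total.Pt) × (L.coord.Pt → L'.coord.Pt)
  id _ := (id, id)
  comp f g := (g.1 ∘ f.1, g.2 ∘ f.2)

/-- `f` is a strict morphism between local 2-∅ coordinate spaces with the same pair of
categories. -/
structure IsStrictLCSMorphism {L L' : LCSData.{u, v} s 𝕜} (f : L ⟶ L') : Prop where
  totalCat_eq : L.totalCat = L'.totalCat
  coordCat_eq : L.coordCat = L'.coordCat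
  atlas : IsMAtlasMorphism L.atlas L'.atlas f.1 f.2
  total_mor : L'.totalCat.mor L.total L'.total f.1
  coord_mor : L'.coordCat.mor L.coord L'.coord f.2

/-! ### The categories and the functors -/

/-- A collection of objects and of arrows of a category. -/
structure SubCat (𝒰 : Type t) [Category.{u} 𝒰] where
  obj : Set 𝒰
  arr : ∀ {a b : 𝒰}, (a ⟶ b) → Prop

namespace SubCat

variable {𝒰 : Type t} [Category.{u} 𝒰] {𝒱 : Type v} [Category.{w} 𝒱]

/-- The collection is a category, with the composition and identities of `𝒰`. -/
structure IsCategory (D : SubCat 𝒰) : Prop where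
  arr_obj : ∀ {a b : 𝒰} (f : a ⟶ b), D.arr f → a ∈ D.obj ∧ b ∈ D.obj
  arr_id : ∀ a ∈ D.obj, D.arr (𝟙 a)
  arr_comp : ∀ {a b c : 𝒰} (f : a ⟶ b) (g : b ⟶ c), D.arr f → D.arr g → D.arr (f ≫ g)

/-- The objects of the category given by the collection. -/
def Obj {D : SubCat 𝒰} (_ : D.IsCategory) : Type t := {a : 𝒰 // a ∈ D.obj}

instance {D : SubCat 𝒰} (h : D.IsCategory) : Category (Obj h) where
  Hom a b := {f : a.1 ⟶ b.1 // D.arr f}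
  id a := ⟨𝟙 a.1, h.arr_id a.1 a.2⟩
  comp f g := ⟨f.1 ≫ g.1, h.arr_comp f.1 g.1 f.2 g.2⟩
  id_comp f := Subtype.ext (Category.id_comp f.1)
  comp_id f := Subtype.ext (Category.comp_id f.1)
  assoc f g k := Subtype.ext (Category.assoc f.1 g.1 k.1)

/-- `F` maps the objects and arrows of `D` to objects and arrows of `D'`. -/
structure Respects (F : 𝒰 ⥤ 𝒱) (D : SubCat 𝒰) (D' : SubCat 𝒱) : Prop where
  obj : ∀ a ∈ D.obj, F.obj a ∈ D'.obj
  arr : ∀ {a b : 𝒰} (f : a ⟶ b), D.arr f → D'.arr (F.map f)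

/-- The functor between the categories given by `D` and `D'` that `F` induces. -/
def restrict {F : 𝒰 ⥤ 𝒱} {D : SubCat 𝒰} {D' : SubCat 𝒱} (h : D.IsCategory) (h' : D'.IsCategory)
    (hF : Respects F D D') : Obj h ⥤ Obj h' where
  obj a := ⟨F.obj a.1, hF.obj a.1 a.2⟩
  map f := ⟨F.map f.1, hF.arr f.1 f.2⟩
  map_id a := Subtype.ext (F.map_id a.1)
  map_comp f g := Subtype.ext (F.map_comp f.1 g.1)

/-- The arrows of the form `F.map f`, where `f` is an arrow of `D`. -/
inductive ImageArr (F : 𝒰 ⥤ 𝒱) (D : SubCat 𝒰) : ∀ {a b : 𝒱}, (a ⟶ b) → Prop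
  | mk {a b : 𝒰} (f : a ⟶ b) (hf : D.arr f) : ImageArr F D (F.map f)

/-- The image of a collection of objects and arrows under a functor. -/
def image (F : 𝒰 ⥤ 𝒱) (D : SubCat 𝒰) : SubCat 𝒱 where
  obj := F.obj '' D.obj
  arr f := ImageArr F D f

end SubCat

/-- `Man^{C^k}(Es, Cs)`: the `C^k` manifolds `(E, C, A)` with `E ∈ Es`, `C ∈ Cs`, and their `C^k`
morphisms. -/
def manCat (k : WithTop ℕ∞) (Es : Set TopCat.{u}) (Cs : Set (LinSpace.{v} s 𝕜)) :
    SubCat (ManData.{u, v} s 𝕜) where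
  obj := {S | S.space ∈ Es ∧ S.coord ∈ Cs ∧ IsCkManifold k S}
  arr {S S'} f := (S.space ∈ Es ∧ S.coord ∈ Cs ∧ IsCkManifold k S) ∧
    (S'.space ∈ Es ∧ S'.coord ∈ Cs ∧ IsCkManifold k S') ∧
    IsCkAtlasMorphism k S.atlas S'.atlas f.1 f.2

/-- `(E, C, A) ↦ ((ℰ, 𝒞), (Triv E, Triv_{C^k} C), A, ∅, ∅)`, the identity on pairs of functions. -/
def manToLCS (k : WithTop ℕ∞) (ℰ : SpaceCat TopCat.{u}) (𝒞 : SpaceCat (LinSpace.{v} s 𝕜)) :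
    ManData.{u, v} s 𝕜 ⥤ LCSData.{u, v} s 𝕜 where
  obj S := ⟨ℰ, 𝒞, triv S.space, trivCk k S.coord, S.atlas⟩
  map f := f

/-- `((𝓜₀, 𝓜₁), ((E, _), (C, _)), A, ∅, ∅) ↦ (E, C, A)`, the identity on pairs of functions. -/
def lcsToMan : LCSData.{u, v} s 𝕜 ⥤ ManData.{u, v} s 𝕜 where
  obj L := ⟨L.total.space, L.coord.space, L.atlas⟩
  map f := f

/-- `LCS^{C^k,(ℰ,𝒞)}(Es, Cs)`: the objects and arrows that `manToLCS` yields from the `C^k`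
manifolds with `E ∈ Es`, `C ∈ Cs` and their `C^k` morphisms. -/
def lcsCat (k : WithTop ℕ∞) (ℰ : SpaceCat TopCat.{u}) (𝒞 : SpaceCat (LinSpace.{v} s 𝕜))
    (Es : Set TopCat.{u}) (Cs : Set (LinSpace.{v} s 𝕜)) : SubCat (LCSData.{u, v} s 𝕜) :=
  SubCat.image (manToLCS k ℰ 𝒞) (manCat k Es Cs)

end LocalCoord

open LocalCoord

namespace LocalCoord

variable {s : Setting} {𝕜 : Type w} [RCLike 𝕜] {k : WithTop ℕ∞}

/-! ### `C^k` maps and diffeomorphisms -/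

/-! Both functors leave the spaces, the atlas and the pairs of functions untouched, so the content
is that over trivial model spaces the model-theoretic notions are the `C^k` notions. When every open
set is a model neighborhood, every homeomorphism between open sets is an m-chart, and the
isomorphisms of the trivial `C^k` model are exactly the `C^k` diffeomorphisms. Hence m-compatibility
is `C^k` compatibility, and maximality among m-charts is maximality among all charts. Only the ball
condition has no counterpart on the model side; it is dropped in one direction and assumed in the
other.

The substantial point is that atlas morphisms compose (`IsCkAtlasMorphism.comp`). If `f` satisfies
`h ∘ φ' ∘ f₀ = f₁ ∘ φ` near a point, the diffeomorphism `h` stands between `φ'` and the coordinate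
map `g₁` of the next morphism. By maximality of the middle atlas, `φ'` followed by `h` is again a
chart (`IsMaximalCkAtlas.trans_mem`). Applying the condition on `g` to this chart absorbs `h` and
gives `h₂ ∘ φ'' ∘ g₀ ∘ f₀ = g₁ ∘ f₁ ∘ φ`.

No chain rule is proved by calculus. For local self-maps of a coordinate space it is the composition
axiom of the model space `trivCk k C`, an object of `𝒞`; for global maps between coordinate spaces
it is composition in `𝒞`. Continuity of `C^k` maps likewise comes from the morphisms of `𝒞` being
model functions. -/

theorem CkOn.mono {C D : LinSpace.{v} s 𝕜} {f : C.Pt → D.Pt} {U U' : Set C.Pt}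
    (hf : CkOn k f U) (h : U' ⊆ U) : CkOn k f U' := by
  intro x hx
  obtain ⟨O, g, hO, hxO, hg, hgf⟩ := hf x (h hx)
  exact ⟨O, g, hO, hxO, hg, fun y hy => hgf y (h hy)⟩

theorem IsCkDiffeo.symm {C D : LinSpace.{v} s 𝕜} {h : OpenPartialHomeomorph C.Pt D.Pt}
    (hh : IsCkDiffeo k h) : IsCkDiffeo k h.symm :=
  ⟨hh.2, hh.1⟩

theorem trivCkModel_isIso {C : LinSpace.{v} s 𝕜} {h : OpenPartialHomeomorph C.Pt C.Pt} :
    (trivCkModel k C).IsIso h ↔ IsCkDiffeo k h :=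
  ⟨fun H => ⟨H.1.2.2.2, H.2.2.2.2⟩, fun H =>
    ⟨⟨h.open_source, h.open_target, h.mapsTo, H.1⟩,
      ⟨h.open_target, h.open_source, h.mapsTo_symm, H.2⟩⟩⟩

/-- The chain rule is read off from the composition axiom of the trivial `C^k` model. Taking the
whole space as the target of `g` makes the condition on its values vacuous. -/
theorem CkOn.comp_of_isModel {C : LinSpace.{v} s 𝕜} (hC : (trivCkModel k C).IsModel)
    {f g : C.Pt → C.Pt} {U V : Set C.Pt} (hU : IsOpen U) (hV : IsOpen V) (hg : CkOn k g V)
    (hf : CkOn k f U) (h : MapsTo f U V) : CkOn k (g ∘ f) U :=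
  (hC.mor_comp U V univ f g ⟨hU, hV, h, hf⟩ ⟨hV, isOpen_univ, mapsTo_univ _ _, hg⟩).2.2.2

theorem IsCkDiffeo.trans_of_isModel {C : LinSpace.{v} s 𝕜} (hC : (trivCkModel k C).IsModel)
    {h h' : OpenPartialHomeomorph C.Pt C.Pt} (H : IsCkDiffeo k h) (H' : IsCkDiffeo k h') :
    IsCkDiffeo k (h.trans h') := by
  -- Only one direction needs an argument: the inverse of a composite is the composite of the
  -- inverses in reverse order, so the same claim covers it.
  have key : ∀ {e e' : OpenPartialHomeomorph C.Pt C.Pt}, CkOn k e e.source →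
      CkOn k e' e'.source → CkOn k (e.trans e') (e.trans e').source := by
    intro e e' he he'
    refine CkOn.comp_of_isModel (f := e) (g := e') hC (e.trans e').open_source e'.open_source he'
      (he.mono fun x hx => ?_) fun x hx => ?_
    · rw [OpenPartialHomeomorph.trans_source] at hx
      exact hx.1
    · rw [OpenPartialHomeomorph.trans_source] at hx
      exact hx.2
  refine ⟨key H.1 H'.1, ?_⟩
  have := key (e := h'.symm) (e' := h.symm) H'.2 H.2
  rwa [← OpenPartialHomeomorph.trans_symm_eq_symm_trans_symm] at this

/-! ### Atlases of trivial model spaces -/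

/-- Homeomorphisms between open sets preserve openness in both directions. Thus the restriction to
m-charts in the definition of a maximal m-atlas excludes nothing here. -/
theorem isMChart_triv {E : TopCat.{u}} {C : LinSpace.{v} s 𝕜}
    (φ : OpenPartialHomeomorph E C.Pt) : IsMChart (E := triv E) (C := trivCk k C) φ where
  source := φ.open_source
  target := φ.open_target
  preimage _ hV _ := φ.isOpen_inter_preimage hV
  image _ hU h := φ.isOpen_image_of_subset_source hU h

theorem mCompatible_triv {E : TopCat.{u}} {C : LinSpace.{v} s 𝕜}
    {φ ψ : OpenPartialHomeomorph E C.Pt} :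
    MCompatible (E := triv E) (C := trivCk k C) φ ψ ↔ CkCompatible k φ ψ :=
  or_congr Iff.rfl trivCkModel_isIso

theorem IsMaximalCkAtlas.isMaximalMAtlas_triv {E : TopCat.{u}} {C : LinSpace.{v} s 𝕜}
    {A : Set (OpenPartialHomeomorph E C.Pt)} (hA : IsMaximalCkAtlas k A) :
    IsMaximalMAtlas (E := triv E) (C := trivCk k C) A where
  chart φ _ := isMChart_triv φ
  compatible φ hφ ψ hψ := mCompatible_triv.2 (hA.compatible φ hφ ψ hψ)
  cover := hA.cover
  maximal φ _ h := hA.maximal φ fun ψ hψ => mCompatible_triv.1 (h ψ hψ)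

theorem isMaximalCkAtlas_of_triv {E : TopCat.{u}} {C : LinSpace.{v} s 𝕜}
    {A : Set (OpenPartialHomeomorph E C.Pt)}
    (hA : IsMaximalMAtlas (E := triv E) (C := trivCk k C) A)
    (hball : ∃ φ ∈ A, (interior ((fun p : C.Pt => (p : C.amb.Vec)) '' φ.target)).Nonempty) :
    IsMaximalCkAtlas k A where
  compatible φ hφ ψ hψ := mCompatible_triv.1 (hA.compatible φ hφ ψ hψ)
  cover := hA.cover
  ball := hball
  maximal φ h := hA.maximal φ (isMChart_triv φ) fun ψ hψ => mCompatible_triv.2 (h ψ hψ)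

theorem isModelFunction_of_continuous_triv {E E' : TopCat.{u}} {f : E → E'} (hf : Continuous f) :
    (triv E).IsModelFunction (triv E') f :=
  ⟨hf, fun _ hV => IsOpen.preimage hf hV, fun _ _ => ⟨univ, isOpen_univ, subset_univ _⟩⟩

/-- The local witnesses carry over unchanged. That `f₁` is a model function is a separate assumption
because it includes continuity, which is later obtained from `𝒞`. -/
theorem IsCkAtlasMorphism.isMAtlasMorphism_triv {E E' : TopCat.{u}} {C C' : LinSpace.{v} s 𝕜}
    {A : Set (OpenPartialHomeomorph E C.Pt)} {A' : Set (OpenPartialHomeomorph E' C'.Pt)}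
    {f₀ : E → E'} {f₁ : C.Pt → C'.Pt} (hf : IsCkAtlasMorphism k A A' f₀ f₁)
    (hf₁ : (trivCk k C).IsModelFunction (trivCk k C') f₁) :
    IsMAtlasMorphism (E := triv E) (C := trivCk k C) (E' := triv E') (C' := trivCk k C')
      A A' f₀ f₁ where
  model₀ := isModelFunction_of_continuous_triv hf.cont
  model₁ := hf₁
  nearly_commutes φ hφ φ' hφ' x hx := by
    obtain ⟨U, V, U', h, hU, hUs, hV, hVs, hU', hUs', hs, hh, rest⟩ :=
      hf.nearly_commutes φ hφ φ' hφ' x hx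
    exact ⟨U, hU, V, hV, U', hU', h, hUs, hVs, hUs', hs, trivCkModel_isIso.2 hh, rest⟩

/-! ### Composition of atlas morphisms -/

section Morphisms

variable {E E' E'' : Type u} [TopologicalSpace E] [TopologicalSpace E'] [TopologicalSpace E'']
  {C C' C'' : LinSpace.{v} s 𝕜}

theorem CkCompatible.isCkDiffeo {φ ψ : OpenPartialHomeomorph E C.Pt} (h : CkCompatible k φ ψ)
    {x : E} (hφ : x ∈ φ.source) (hψ : x ∈ ψ.source) : IsCkDiffeo k (φ.symm.trans ψ) :=
  h.resolve_left fun hd => disjoint_left.1 hd hφ hψ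

/-- The transition from `φ.trans h` to a chart `χ` is `h⁻¹` followed by the transition from `φ` to
`χ`, hence a diffeomorphism. If `φ` and `χ` have disjoint domains, so do `φ.trans h` and `χ`, since
composing with `h` can only shrink the domain. -/
theorem IsMaximalCkAtlas.trans_mem (hC : (trivCkModel k C).IsModel)
    {A : Set (OpenPartialHomeomorph E C.Pt)} (hA : IsMaximalCkAtlas k A)
    {φ : OpenPartialHomeomorph E C.Pt} (hφ : φ ∈ A) {h : OpenPartialHomeomorph C.Pt C.Pt}
    (hh : IsCkDiffeo k h) : φ.trans h ∈ A := by
  refine hA.maximal _ fun χ hχ => ?_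
  rcases hA.compatible φ hφ χ hχ with hd | hd
  · refine Or.inl (hd.mono_left ?_)
    rw [OpenPartialHomeomorph.trans_source]
    exact inter_subset_left
  · refine Or.inr ?_
    rw [OpenPartialHomeomorph.trans_symm_eq_symm_trans_symm, OpenPartialHomeomorph.trans_assoc]
    exact hh.symm.trans_of_isModel hC hd

/-- For two charts `φ`, `φ'` around `x`, the required diffeomorphism is their transition function:
`(φ ∘ φ'⁻¹) ∘ φ' = φ` on the common domain. -/
theorem IsCkAtlas.isCkAtlasMorphism_id {A : Set (OpenPartialHomeomorph E C.Pt)}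
    (hA : IsCkAtlas k A) (hid : CkOn k (id : C.Pt → C.Pt) univ) :
    IsCkAtlasMorphism k A A id id where
  cont := continuous_id
  Ck := hid
  nearly_commutes φ hφ φ' hφ' x hx := by
    have hx' : x ∈ φ'.source := hx.2
    have hcomp := (hA.compatible φ' hφ' φ hφ).isCkDiffeo hx' hx.1
    have hmap : MapsTo φ (φ.source ∩ φ'.source) (φ'.symm.trans φ).target := by
      intro y hy
      rw [OpenPartialHomeomorph.trans_target]
      exact ⟨φ.map_source hy.1, by simpa [φ.left_inv hy.1] using hy.2⟩
    refine ⟨φ.source ∩ φ'.source, (φ'.symm.trans φ).target, φ.source ∩ φ'.source,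
      φ'.symm.trans φ, φ.open_source.inter φ'.open_source, subset_rfl,
      (φ'.symm.trans φ).open_target, ?_, φ.open_source.inter φ'.open_source, inter_subset_right,
      ?_, hcomp, ⟨hx.1, hx'⟩, hmap ⟨hx.1, hx'⟩, mapsTo_id _, hmap, mapsTo_id _, ?_, ?_⟩
    · rw [OpenPartialHomeomorph.trans_target]
      exact inter_subset_left
    · rw [OpenPartialHomeomorph.trans_source]
      exact inter_subset_left
    · intro y hy
      rw [OpenPartialHomeomorph.trans_source]
      exact ⟨φ'.map_source hy.2, by simpa [φ'.left_inv hy.2] using hy.1⟩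
    · intro y hy
      simp [φ'.left_inv hy.2]

theorem IsCkAtlasMorphism.comp {A : Set (OpenPartialHomeomorph E C.Pt)}
    {A' : Set (OpenPartialHomeomorph E' C'.Pt)} {A'' : Set (OpenPartialHomeomorph E'' C''.Pt)}
    {f₀ : E → E'} {f₁ : C.Pt → C'.Pt} {g₀ : E' → E''} {g₁ : C'.Pt → C''.Pt}
    (hC' : (trivCkModel k C').IsModel) (hA' : IsMaximalCkAtlas k A')
    (hg : IsCkAtlasMorphism k A' A'' g₀ g₁) (hf : IsCkAtlasMorphism k A A' f₀ f₁)
    (hf₁ : Continuous f₁) (hgf : CkOn k (g₁ ∘ f₁) univ) :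
    IsCkAtlasMorphism k A A'' (g₀ ∘ f₀) (g₁ ∘ f₁) where
  cont := hg.cont.comp hf.cont
  Ck := hgf
  nearly_commutes φ hφ φ'' hφ'' x hx := by
    -- The condition to be shown mentions no chart of the middle space, so any chart around `f₀ x`
    -- may be inserted.
    obtain ⟨φ', hφ', hxφ'⟩ := hA'.cover (f₀ x)
    obtain ⟨U, V, U', h, hU, hUs, hV, hVs, -, hUs', -, hh, hxU, -, hfU, hφU, -, hφU', heq⟩ :=
      hf.nearly_commutes φ hφ φ' hφ' x ⟨hx.1, hxφ'⟩
    have hxψ : f₀ x ∈ (φ'.trans h).source := by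
      rw [OpenPartialHomeomorph.trans_source]
      exact ⟨hxφ', hφU' (hfU hxU)⟩
    -- The condition on `g` is used at the corrected chart `φ'.trans h` instead of `φ'`: in that
    -- chart `f₀` is represented exactly by `f₁`, without a correcting diffeomorphism.
    obtain ⟨W, V₂, W', h₂, hW, hWs, hV₂, -, hW', hWs', hs₂, hh₂, hxW, hxt, hgW, hψW, hgV, hφW,
      heq₂⟩ := hg.nearly_commutes _ (hA'.trans_mem hC' hφ' hh) φ'' hφ'' (f₀ x) ⟨hxψ, hx.2⟩
    have hval : ∀ y ∈ U, (φ'.trans h) (f₀ y) = f₁ (φ y) := fun y hy => heq y hy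
    -- The source neighborhoods for `f` are cut down so that the condition on `g` applies after `f₀`
    -- and `f₁`; openness of the second one needs continuity of `f₁`. The target data are those of
    -- `g`.
    refine ⟨U ∩ f₀ ⁻¹' W, V ∩ f₁ ⁻¹' V₂, W', h₂, hU.inter (hW.preimage hf.cont),
      fun y hy => ⟨(hUs hy.1).1, (hWs hy.2).2⟩, hV.inter (hV₂.preimage hf₁),
      fun y hy => hVs hy.1, hW', hWs', hs₂, hh₂, ⟨hxU, hxW⟩, ?_, fun y hy => hgW hy.2,
      fun y hy => ⟨hφU hy.1, ?_⟩, fun y hy => hgV hy.2, hφW, fun y hy => ?_⟩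
    · rw [hval x hxU] at hxt
      exact hxt
    · have := hψW hy.2
      rw [hval y hy.1] at this
      exact this
    · have := heq₂ (f₀ y) hy.2
      rw [hval y hy.1] at this
      exact this

end Morphisms

/-! ### The two categories -/

section Categories

variable {Es : Set TopCat.{u}} {Cs : Set (LinSpace.{v} s 𝕜)} {ℰ : SpaceCat TopCat.{u}}
  {𝒞 : SpaceCat (LinSpace.{v} s 𝕜)}

theorem ContainsTrivCk.isModel (h𝒞 : IsCkLinearModelCategory k 𝒞)
    (hT : ContainsTrivCk k Cs 𝒞) {C : LinSpace.{v} s 𝕜} (hC : C ∈ Cs) :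
    (trivCkModel k C).IsModel :=
  (h𝒞.obj_linear _ (hT.1 C hC)).1.2

theorem ContainsTrivCk.isModelFunction (h𝒞 : IsCkLinearModelCategory k 𝒞)
    (hT : ContainsTrivCk k Cs 𝒞) {C C' : LinSpace.{v} s 𝕜} (hC : C ∈ Cs) (hC' : C' ∈ Cs)
    {f : C.Pt → C'.Pt} (hf : CkOn k f univ) : (trivCk k C).IsModelFunction (trivCk k C') f :=
  (h𝒞.mor_Ck _ _ _ ((hT.2 C hC C' hC' f).2 hf)).1

theorem manCat_isCategory (h𝒞 : IsCkLinearModelCategory k 𝒞) (hT : ContainsTrivCk k Cs 𝒞) :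
    (manCat (𝕜 := 𝕜) (s := s) k Es Cs).IsCategory where
  arr_obj f hf := ⟨hf.1, hf.2.1⟩
  arr_id a ha := ⟨ha, ha, ha.2.2.2.toIsCkAtlas.isCkAtlasMorphism_id
    ((hT.2 _ ha.2.1 _ ha.2.1 id).1 (h𝒞.mor_id _ (hT.1 _ ha.2.1)))⟩
  arr_comp {a b c} f g hf hg := by
    have hb := hg.1
    refine ⟨hf.1, hg.2.1, IsCkAtlasMorphism.comp (f₀ := f.1) (f₁ := f.2) (g₀ := g.1) (g₁ := g.2)
      (hT.isModel h𝒞 hb.2.1) hb.2.2.2 hg.2.2 hf.2.2 ?_ ?_⟩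
    · exact (hT.isModelFunction h𝒞 hf.1.2.1 hb.2.1 hf.2.2.Ck).1
    · exact (hT.2 _ hf.1.2.1 _ hg.2.1.2.1 _).1 (h𝒞.mor_comp _ _ _ _ _
        ((hT.2 _ hf.1.2.1 _ hb.2.1 _).2 hf.2.2.Ck) ((hT.2 _ hb.2.1 _ hg.2.1.2.1 _).2 hg.2.2.Ck))

/-- The image of a functor need not be closed under composition, since arrows that become composable
may come from non-composable ones. Here `lcsToMan` undoes `manToLCS`, so membership of an arrow can
be tested on its end points and its underlying pair of functions, and the category axioms transfer
from manifolds. -/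
theorem lcsCat_arr_iff {L L' : LCSData.{u, v} s 𝕜} (f : L ⟶ L') :
    (lcsCat k ℰ 𝒞 Es Cs).arr f ↔ L ∈ (lcsCat k ℰ 𝒞 Es Cs).obj ∧
      L' ∈ (lcsCat k ℰ 𝒞 Es Cs).obj ∧ (manCat k Es Cs).arr (lcsToMan.map f) := by
  constructor
  · rintro ⟨f, hf⟩
    exact ⟨⟨_, hf.1, rfl⟩, ⟨_, hf.2.1, rfl⟩, hf⟩
  · rintro ⟨⟨S, -, rfl⟩, ⟨S', -, rfl⟩, h⟩
    exact SubCat.ImageArr.mk (F := manToLCS k ℰ 𝒞) (a := S) (b := S') f h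

theorem lcsCat_isCategory (hM : (manCat (𝕜 := 𝕜) (s := s) k Es Cs).IsCategory) :
    (lcsCat k ℰ 𝒞 Es Cs).IsCategory where
  arr_obj f hf := ⟨((lcsCat_arr_iff f).1 hf).1, ((lcsCat_arr_iff f).1 hf).2.1⟩
  arr_id a ha := by
    refine (lcsCat_arr_iff _).2 ⟨ha, ha, ?_⟩
    obtain ⟨S, hS, rfl⟩ := ha
    exact hM.arr_id S hS
  arr_comp f g hf hg := by
    rw [lcsCat_arr_iff] at hf hg ⊢
    refine ⟨hf.1, hg.2.1, ?_⟩
    rw [Functor.map_comp]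
    exact hM.arr_comp _ _ hf.2.2 hg.2.2

theorem lcsToMan_respects :
    SubCat.Respects lcsToMan (lcsCat k ℰ 𝒞 Es Cs) (manCat k Es Cs) where
  obj := by
    rintro _ ⟨S, hS, rfl⟩
    exact hS
  arr f hf := ((lcsCat_arr_iff f).1 hf).2.2

theorem manToLCS_respects :
    SubCat.Respects (manToLCS k ℰ 𝒞) (manCat k Es Cs) (lcsCat k ℰ 𝒞 Es Cs) where
  obj S hS := ⟨S, hS, rfl⟩
  arr f hf := SubCat.ImageArr.mk f hf

theorem manToLCS_comp_lcsToMan (hM : (manCat k Es Cs).IsCategory)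
    (hL : (lcsCat k ℰ 𝒞 Es Cs).IsCategory) :
    SubCat.restrict hM hL manToLCS_respects ⋙ SubCat.restrict hL hM lcsToMan_respects =
      𝟭 (SubCat.Obj hM) :=
  rfl

/-- An object of the image is rebuilt from its underlying manifold only because it arose from one:
passing to the manifold forgets the model structures and the pair of categories. Once a preimage is
exposed, both sides agree by definition. -/
theorem lcsToMan_comp_manToLCS (hM : (manCat k Es Cs).IsCategory)
    (hL : (lcsCat k ℰ 𝒞 Es Cs).IsCategory) :
    SubCat.restrict hL hM lcsToMan_respects ⋙ SubCat.restrict hM hL manToLCS_respects =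
      𝟭 (SubCat.Obj hL) := by
  refine Functor.hext ?_ ?_
  · rintro ⟨_, S, hS, rfl⟩
    rfl
  · rintro ⟨_, S, hS, rfl⟩ ⟨_, S', hS', rfl⟩ f
    rfl

/-! ### Manifolds as local coordinate spaces -/

theorem isLCS_of_mem_lcsCat (hℰ : ℰ.IsModelCategory) (h𝒞 : 𝒞.IsModelCategory)
    (hTℰ : ContainsTriv Es ℰ) (hT𝒞 : ContainsTrivCk k Cs 𝒞) {L : LCSData.{u, v} s 𝕜}
    (hL : L ∈ (lcsCat k ℰ 𝒞 Es Cs).obj) : IsLCS L := by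
  obtain ⟨S, hS, rfl⟩ := hL
  exact ⟨hℰ, h𝒞, hTℰ.1 _ hS.1, hT𝒞.1 _ hS.2.1, hS.2.2.2.isMaximalMAtlas_triv⟩

theorem isStrictLCSMorphism_of_lcsCat_arr (h𝒞 : IsCkLinearModelCategory k 𝒞)
    (hTℰ : ContainsTriv Es ℰ) (hT𝒞 : ContainsTrivCk k Cs 𝒞) {L L' : LCSData.{u, v} s 𝕜}
    {f : L ⟶ L'} (hf : (lcsCat k ℰ 𝒞 Es Cs).arr f) : IsStrictLCSMorphism f := by
  obtain ⟨f, hS, hS', hf⟩ := hf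
  exact ⟨rfl, rfl, hf.isMAtlasMorphism_triv (hT𝒞.isModelFunction h𝒞 hS.2.1 hS'.2.1 hf.Ck),
    (hTℰ.2 _ hS.1 _ hS'.1 _).2 hf.cont, (hT𝒞.2 _ hS.2.1 _ hS'.2.1 _).2 hf.Ck⟩

/-! ### Local coordinate spaces as manifolds -/

theorem IsLCS.isCkManifold {L : LCSData.{u, v} s 𝕜} (hL : IsLCS L)
    (hA : IsMaximalCkAtlas (C := L.coord.space) k L.atlas) : IsCkManifold k (lcsToMan.obj L) :=
  ⟨(hL.coord_cat.obj_model _ hL.coord_mem).1, hA⟩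

theorem IsLCS.isCkManifold_of_triv {L : LCSData.{u, v} s 𝕜} (hL : IsLCS L)
    (ht : L.total = triv L.total.space) (hc : L.coord = trivCk k L.coord.space)
    (hball : ∃ φ ∈ L.atlas, (interior ((fun p : L.coord.space.Pt => (p : L.coord.space.amb.Vec)) ''
      φ.target)).Nonempty) : IsCkManifold k (lcsToMan.obj L) := by
  refine hL.isCkManifold ?_
  have hA := hL.atlas
  -- The types of the charts depend on the model spaces in `L`. Splitting `L` reduces the two
  -- hypotheses to equations between model structures on fixed spaces, which can then be
  -- substituted.
  obtain ⟨M₀, M₁, ⟨E, Em⟩, ⟨C, Cm⟩, A⟩ := L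
  simp only [triv, trivCk, ModelSpace.mk.injEq, heq_eq_eq, true_and] at ht hc
  change Em = trivModel E at ht
  change Cm = trivCkModel k C at hc
  subst ht hc
  exact isMaximalCkAtlas_of_triv hA hball

end Categories

end LocalCoord

theorem mainTheorem3 (s : Setting) (𝕜 : Type w) [RCLike 𝕜] (k : WithTop ℕ∞)
    (Es : Set TopCat.{u}) (Cs : Set (LinSpace.{v} s 𝕜)) (hCs : ∀ C ∈ Cs, C.IsLinear)
    (ℰ : SpaceCat TopCat.{u}) (𝒞 : SpaceCat (LinSpace.{v} s 𝕜))
    (hℰ : ℰ.IsModelCategory) (h𝒞 : IsCkLinearModelCategory k 𝒞)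
    (hTℰ : ContainsTriv Es ℰ) (hT𝒞 : ContainsTrivCk k Cs 𝒞) :
    -- a local 2-∅ coordinate space with `C^k` linear coordinate space whose atlas is a maximal
    -- `C^k`-atlas yields a `C^k` manifold
    (∀ L : LCSData.{u, v} s 𝕜, IsLCS L → IsCkLinearModelCategory k L.coordCat →
      IsMaximalCkAtlas (C := L.coord.space) k L.atlas → IsCkManifold k (lcsToMan.obj L)) ∧
    -- for trivial model spaces the atlas is automatically a maximal `C^k`-atlas, as soon as the
    -- range of some chart contains a ball
    (∀ L : LCSData.{u, v} s 𝕜, IsLCS L → IsCkLinearModelCategory k L.coordCat →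
      L.total = triv L.total.space → L.coord = trivCk k L.coord.space →
      (∃ φ ∈ L.atlas, (interior ((fun p : L.coord.space.Pt => (p : L.coord.space.amb.Vec)) ''
        φ.target)).Nonempty) → IsCkManifold k (lcsToMan.obj L)) ∧
    -- the objects and arrows of `LCS^{C^k,(ℰ,𝒞)}(Es, Cs)` are local 2-∅ coordinate spaces and
    -- strict morphisms of them
    (𝒞.IsModelCategory → (∀ L ∈ (lcsCat k ℰ 𝒞 Es Cs).obj, IsLCS L) ∧
      ∀ (L L' : LCSData.{u, v} s 𝕜) (f : L ⟶ L'), (lcsCat k ℰ 𝒞 Es Cs).arr f →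
        IsStrictLCSMorphism f) ∧
    -- both are categories, and the two functors between them are mutually inverse
    ∃ (hM : (manCat k Es Cs).IsCategory) (hL : (lcsCat k ℰ 𝒞 Es Cs).IsCategory)
      (hF : SubCat.Respects lcsToMan (lcsCat k ℰ 𝒞 Es Cs) (manCat k Es Cs))
      (hG : SubCat.Respects (manToLCS k ℰ 𝒞) (manCat k Es Cs) (lcsCat k ℰ 𝒞 Es Cs)),
      SubCat.restrict hM hL hG ⋙ SubCat.restrict hL hM hF = 𝟭 (SubCat.Obj hM) ∧
      SubCat.restrict hL hM hF ⋙ SubCat.restrict hM hL hG = 𝟭 (SubCat.Obj hL) := by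
  have hM := manCat_isCategory (Es := Es) h𝒞 hT𝒞
  have hL := lcsCat_isCategory (ℰ := ℰ) (𝒞 := 𝒞) hM
  exact ⟨fun _ h _ hA => h.isCkManifold hA, fun _ h _ ht hc hb => h.isCkManifold_of_triv ht hc hb,
    fun h => ⟨fun _ hL => isLCS_of_mem_lcsCat hℰ h hTℰ hT𝒞 hL,
      fun _ _ _ hf => isStrictLCSMorphism_of_lcsCat_arr h𝒞 hTℰ hT𝒞 hf⟩,
    hM, hL, lcsToMan_respects, manToLCS_respects, manToLCS_comp_lcsToMan hM hL,
    lcsToMan_comp_manToLCS hM hL⟩
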